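/- There is an absolute constant $C>0$ such that the following holds. Let $d,n,k\ge1$ be integers, let $0<\delta,\epsilon<1$ and $\sqrt2\le\alpha\le2$, let $\mathcal X\subseteq\mathbb R^d$, and let $f:\mathbb R^d\to[0,\infty)$ be a probability density with respect to Lebesgue measure that vanishes outside $\mathcal X$. Let $X_n=(x_1,\dots,x_n)$ be an i.i.d. sample from $f$, and assume $$k\ \ge\ C\cdot\frac{d\log n}{\epsilon^2}\cdot\log^2\frac2\delta .$$ Write $B(x,\rho)$ for closed Euclidean balls, $v_d$ for the volume of the unit ball of $\mathbb R^d$, $Z_\sigma=\{y\in\mathbb R^d:\inf_{z\in Z}\|y-z\|\le\sigma\}$, $\Lambda=\sup_{x\in\mathcal X}f(x)\in[0,\infty]$, and $r_k(x_i)=\min\{\rho: B(x_i,\rho)\text{ contains at least }k\text{ data points}\}$ (with $r_k(x_i)=\infty$ if $k>n$). For $\rho\ge0$ let $G^{\rm NN}_\rho$ be the graph with nodes $\{x_i:r_k(x_i)\le \rho\}$ in which $x_i,x_j$ are adjacent iff $\|x_i-x_j\|\le\alpha\min(r_k(x_i),r_k(x_j))$ (mutual $k$-NN graph). The same theorem is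 asserted for the variant with $\max$ in place of $\min$ ($k$-NN graph). Then there is a mapping $r:[0,\infty)\to[0,\infty)$, with $\frac kn\le v_d\,r(\lambda)^d\lambda\le\frac kn\left(1+\frac\epsilon2\right)$ for all $\lambda>0$, such that with probability at least $1-\delta$ the following holds for all $\sigma>0$ and all path-connected (nonempty) sets $A,A'\subseteq\mathcal X$. Suppose that * any two points of $\mathcal X$ at distance at most $\sigma$ are joined by a straight segment inside $\mathcal X$ (which holds, for instance, if $\mathcal X$ is convex or $\mathcal X=\mathbb R^d$); * $A,A'$ are $(\sigma,\epsilon)$-separated, that is, there is $S\subseteq\mathcal X$ such that every path in $\mathcal X$ from $A$ to $A'$ meets $S$, and $\sup_{x\in S_\sigma}f(x)<(1-\epsilon)\lambda$, where $\lambda=\inf_{x\in A_\sigma\cup A'_\sigma}f(x)$ (a supremum over the empty set being $0$); * $n\ge\dfrac{k}{v_d(\sigma/2)^d\lambda}\left(1+\dfrac\epsilon2\right)$ and $k\ge\dfrac\Lambda\lambda\cdot C\,d\log n\cdot\log\dfrac2\delta$. Then: 1. (Separation) $A\cap X_n$ is disconnected from $A'\cap X_n$ in $G^{\rm NN}_{r(\lambda)}$: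 no node in $A$ lies in the same connected component as a node in $A'$. 2. (Connectedness) $A\cap X_n$ and $A'\cap X_n$ are each connected in $G^{\rm NN}_{r(\lambda)}$: all points of $A\cap X_n$ are nodes and lie in one connected component, and likewise for $A'$. -/

import Mathlib

open MeasureTheory
open scoped NNReal ENNReal

namespace ClusterTree

/-- Euclidean space `ℝ^d`. -/
abbrev E (d : ℕ) : Type := EuclideanSpace ℝ (Fin d)

/-- `v_d`, the Lebesgue volume of the unit ball of `ℝ^d`. -/
noncomputable def unitBallVolume (d : ℕ) : ℝ :=
  (volume (Metric.closedBall (0 : E d) 1)).toReal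

/-- `f` is a probability density (with respect to Lebesgue measure) supported on `X`;
it is a function on the whole space that vanishes outside `X`. -/
structure IsDensityOn {d : ℕ} (f : E d → ℝ≥0) (X : Set (E d)) : Prop where
  measurable : Measurable f
  lintegral_eq_one : ∫⁻ x, (f x : ℝ≥0∞) = 1
  eq_zero_of_notMem : ∀ x, x ∉ X → f x = 0

/-- The law of an i.i.d. sample `x_1, …, x_n` drawn from the density `f`. -/
noncomputable def sampleLaw {d : ℕ} (f : E d → ℝ≥0) (n : ℕ) : Measure (Fin n → E d) :=
  Measure.pi fun _ => volume.withDensity fun x => (f x : ℝ≥0∞)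

/-! ### Cluster salience

The closed `σ`-neighbourhood `Z_σ = {y | inf_{z ∈ Z} ‖y - z‖ ≤ σ}` is `Metric.cthickening σ Z`. -/

/-- `λ = inf {f x | x ∈ A_σ ∪ A'_σ}` (used for nonempty `A`, `A'` only). -/
noncomputable def level {d : ℕ} (f : E d → ℝ≥0) (σ : ℝ) (A A' : Set (E d)) : ℝ≥0 :=
  sInf (f '' (Metric.cthickening σ A ∪ Metric.cthickening σ A'))

/-- `A` and `A'` are `(σ, ε)`-separated for the density `f` on `X`: there is a separator `S ⊆ X`
which meets every path in `X` from `A` to `A'`, such that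
`sup_{S_σ} f < (1 - ε) inf_{A_σ ∪ A'_σ} f`. -/
def Separated {d : ℕ} (X : Set (E d)) (f : E d → ℝ≥0) (σ ε : ℝ) (A A' : Set (E d)) : Prop :=
  ∃ S : Set (E d), S ⊆ X ∧
    (∀ a ∈ A, ∀ a' ∈ A', ∀ γ : Path a a', (∀ t, γ t ∈ X) → ∃ t, γ t ∈ S) ∧
    (⨆ x ∈ Metric.cthickening σ S, (f x : ℝ≥0∞)) <
      ENNReal.ofReal (1 - ε) * (level f σ A A' : ℝ≥0∞)

/-- Any two points of `X` at distance at most `σ` are joined by a straight segment inside `X`.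
Every convex set, in particular the whole space, has this property for every `σ`. -/
def ConvexAtScale {d : ℕ} (X : Set (E d)) (σ : ℝ) : Prop :=
  ∀ x ∈ X, ∀ y ∈ X, dist x y ≤ σ → segment ℝ x y ⊆ X

/-! ### The `k`-nearest-neighbour cluster tree -/

/-- `r_k(x_i)`: the least `r` such that the closed ball `B(x_i, r)` contains `k` data points
(`x_i` included), and `∞` if there is no such `r`, that is, if `k > n`. -/
noncomputable def knnRadius {d n : ℕ} (x : Fin n → E d) (k : ℕ) (i : Fin n) : ℝ≥0∞ :=
  ⨅ (r : ℝ≥0) (_ : k ≤ Set.ncard {j : Fin n | x j ∈ Metric.closedBall (x i) (r : ℝ)}), (r : ℝ≥0∞)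

/-- The indices of the nodes `{x_i | r_k(x_i) ≤ r}` of `G^NN_r`. -/
def nodes {d n : ℕ} (x : Fin n → E d) (k : ℕ) (r : ℝ≥0) : Set (Fin n) :=
  {i | knnRadius x k i ≤ (r : ℝ≥0∞)}

/-- The two variants of the `k`-nearest-neighbour graph. -/
inductive Variant where
  | knn
  | mutual

/-- The scale of the edge rule: `max` for the `k`-NN graph, `min` for the mutual `k`-NN graph. -/
noncomputable def Variant.scale : Variant → ℝ≥0∞ → ℝ≥0∞ → ℝ≥0∞
  | .knn, a, b => max a b
  | .mutual, a, b => min a b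

/-- The graph `G^NN_r`: its nodes are the data points with `r_k(x_i) ≤ r`, and two nodes are
adjacent if `‖x_i - x_j‖ ≤ α max (r_k(x_i), r_k(x_j))` (`k`-NN graph), respectively
`‖x_i - x_j‖ ≤ α min (r_k(x_i), r_k(x_j))` (mutual `k`-NN graph). -/
noncomputable def nnGraph {d n : ℕ} (v : Variant) (α : ℝ) (k : ℕ) (x : Fin n → E d) (r : ℝ≥0) :
    SimpleGraph (nodes x k r) :=
  SimpleGraph.fromRel fun i j =>
    edist (x i.1) (x j.1) ≤
      ENNReal.ofReal α * v.scale (knnRadius x k i.1) (knnRadius x k j.1)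

/-- `A ∩ X_n` is disconnected from `A' ∩ X_n` in a graph `G` whose nodes are data points:
no node in `A` is in the same connected component as a node in `A'`. -/
def DisconnectedIn {d n : ℕ} {V : Set (Fin n)} (x : Fin n → E d) (G : SimpleGraph V)
    (A A' : Set (E d)) : Prop :=
  ∀ i j : V, x i.1 ∈ A → x j.1 ∈ A' → ¬ G.Reachable i j

/-- `A ∩ X_n` is connected in a graph `G` whose nodes are data points: all points of `A ∩ X_n`
are nodes of `G`, and they all lie in one connected component of `G`. -/
def ConnectedIn {d n : ℕ} {V : Set (Fin n)} (x : Fin n → E d) (G : SimpleGraph V)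
    (A : Set (E d)) : Prop :=
  ∀ i j : Fin n, x i ∈ A → x j ∈ A → ∃ (hi : i ∈ V) (hj : j ∈ V), G.Reachable ⟨i, hi⟩ ⟨j, hj⟩

end ClusterTree

/-! ### Volumes, finite nets and masses of balls. -/

namespace ClusterTree

variable {d : ℕ}

/-! Fix `r(λ)` by `v_d r(λ)^d λ = (k/n)(1 + ε/2)`. A ball of this radius has mass at least `(k/n)(1
+ ε/2)` where `f ≥ λ`, and at most `(k/n)(1 - ε/2)` where `f ≤ (1 - ε)λ`. So, once ball counts
around sample points concentrate, sample points near a cluster are nodes and those near the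
separator are not.

Concentration needs no uniform bound over a class of balls. Given `x i`, rank the other points by
the mass of the ball around `x i` that reaches them; every radius then becomes a threshold on this
rank, and one Chernoff bound per sample point suffices (`measure_exists_ball_few_le`,
`measure_exists_ball_many_le`).

Separation: edges have length at most `2r ≤ σ`, so they are segments in `X`; one that met `S` would
have an endpoint within `r` of `S`, which is not a node (`disconnectedIn_nnGraph`).

Connectedness: since `f ≤ Λ`, all k-NN radii are at least `r₀`, where `v_d r₀^d = k/(2nΛ)`, so nodes
at distance at most `√2 r₀` are adjacent in both variants. If `b` is within `r₀` of `a`, the half of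
`B(a, r₀)` facing `b` lies in `B(b, √2 r₀)`; hence the constant `√2`. A slightly shrunken form of
this lens contains a sample point for all relevant `a, b` at once, by a union bound over pairs from
a finite net (`measure_exists_gap_le`). Sliding `a` through the cluster then links its sample points
(`connectedIn_nnGraph`). -/

lemma unitBallVolume_pos : 0 < unitBallVolume d :=
  ENNReal.toReal_pos (Metric.measure_closedBall_pos _ _ one_pos).ne' measure_closedBall_lt_top.ne

lemma volume_closedBall_eq (c : E d) {R : ℝ} (hR : 0 ≤ R) :
    volume (Metric.closedBall c R) = ENNReal.ofReal (unitBallVolume d * R ^ d) := by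
  rw [Measure.addHaar_closedBall' _ _ hR, mul_comm,
    ENNReal.ofReal_mul unitBallVolume_pos.le, unitBallVolume,
    ENNReal.ofReal_toReal measure_closedBall_lt_top.ne]
  simp

/-- A half ball has at least half of the volume of the ball. -/
lemma volume_half_ball_ge (c u : E d) {R : ℝ} (hR : 0 ≤ R) :
    ENNReal.ofReal (unitBallVolume d * R ^ d / 2) ≤
      volume (Metric.closedBall c R ∩ {z | 0 ≤ inner ℝ (z - c) u}) := by
  set H := Metric.closedBall c R ∩ {z | 0 ≤ inner ℝ (z - c) u} with hH
  -- The half ball and its point reflection through `c` cover the ball.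
  have hrefl : volume ((fun z => (c + c) - z) ⁻¹' H) = volume H :=
    (Measure.measurePreserving_sub_left volume (c + c)).measure_preimage_equiv
      (f := MeasurableEquiv.subLeft (c + c)) H
  have hcov : Metric.closedBall c R ⊆ H ∪ (fun z => (c + c) - z) ⁻¹' H := by
    intro z hz
    rw [Metric.mem_closedBall, dist_eq_norm] at hz
    rcases le_total 0 (inner ℝ (z - c) u) with h | h
    · exact Or.inl ⟨by simpa [dist_eq_norm] using hz, h⟩
    · have e : c + c - z - c = -(z - c) := by abel
      refine Or.inr ⟨?_, ?_⟩
      · rwa [Metric.mem_closedBall, dist_eq_norm, e, norm_neg]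
      · change 0 ≤ inner ℝ (c + c - z - c) u
        rw [e, inner_neg_left]; linarith
  have h2 : ENNReal.ofReal (unitBallVolume d * R ^ d) ≤ 2 * volume H := by
    rw [← volume_closedBall_eq c hR, two_mul]
    exact (measure_mono hcov).trans ((measure_union_le _ _).trans_eq (by rw [hrefl]))
  rw [ENNReal.ofReal_div_of_pos two_pos]
  refine ENNReal.div_le_of_le_mul ?_
  simpa [mul_comm] using h2

/-- The law of one sample point. -/
noncomputable abbrev law (f : E d → ℝ≥0) : Measure (E d) :=
  volume.withDensity fun x => (f x : ℝ≥0∞)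

lemma IsDensityOn.isProbabilityMeasure {f : E d → ℝ≥0} {X : Set (E d)} (hf : IsDensityOn f X) :
    IsProbabilityMeasure (law f) :=
  ⟨by simpa [law] using hf.lintegral_eq_one⟩

lemma le_law_of_le {f : E d → ℝ≥0} {g : Set (E d)} (hg : MeasurableSet g)
    {l : ℝ≥0∞} (h : ∀ z ∈ g, l ≤ f z) : l * volume g ≤ law f g := by
  rw [law, withDensity_apply _ hg, ← setLIntegral_const]
  exact setLIntegral_mono' hg h

lemma law_le_of_le {f : E d → ℝ≥0} {g : Set (E d)} (hg : MeasurableSet g)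
    {l : ℝ≥0∞} (h : ∀ z ∈ g, (f z : ℝ≥0∞) ≤ l) : law f g ≤ l * volume g := by
  rw [law, withDensity_apply _ hg, ← setLIntegral_const]
  exact setLIntegral_mono' hg h

/-- A region in which the density is bounded below has a small finite net. -/
lemma exists_finite_net (f : E d → ℝ≥0) [IsProbabilityMeasure (law f)] {l h : ℝ} (hl : 0 < l)
    (hh : 0 < h) :
    ∃ N : Finset (E d), (N.card : ℝ) * (l * (unitBallVolume d * (h / 2) ^ d)) ≤ 1 ∧
      ∀ c : E d, (∀ z ∈ Metric.closedBall c (h / 2), l ≤ f z) → ∃ p ∈ N, dist c p ≤ h := by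
  classical
  set m : ℝ := l * (unitBallVolume d * (h / 2) ^ d) with hm
  have hV := unitBallVolume_pos (d := d)
  have hmpos : 0 < m := by positivity
  let D : Set (E d) := {c | ∀ z ∈ Metric.closedBall c (h / 2), l ≤ f z}
  have hball : ∀ c ∈ D, ENNReal.ofReal m ≤ law f (Metric.closedBall c (h / 2)) := by
    intro c hc
    rw [hm, ENNReal.ofReal_mul hl.le, ← volume_closedBall_eq c (by positivity)]
    refine le_law_of_le measurableSet_closedBall fun z hz => ?_
    rw [← ENNReal.ofReal_coe_nnreal]
    exact ENNReal.ofReal_le_ofReal (hc z hz)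
  -- An `h`-separated subset of `D` has disjoint balls of radius `h / 2`, each of mass at least `m`;
  -- hence its size is bounded, and one of maximal size is a net.
  let P : ℕ → Prop := fun j => ∃ N : Finset (E d), N.card = j ∧ (N : Set (E d)) ⊆ D ∧
    (N : Set (E d)).Pairwise fun a b => h < dist a b
  have hcard : ∀ j, P j → (j : ℝ) * m ≤ 1 := by
    rintro j ⟨N, rfl, hND, hsep⟩
    have hdisj : (N : Set (E d)).PairwiseDisjoint fun c => Metric.closedBall c (h / 2) :=
      fun a ha b hb hab => Metric.closedBall_disjoint_closedBall (by linarith [hsep ha hb hab])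
    have h1 : ∑ c ∈ N, law f (Metric.closedBall c (h / 2)) ≤ 1 := by
      rw [← measure_biUnion_finset hdisj fun _ _ => measurableSet_closedBall]
      exact prob_le_one
    have h2 : (N.card : ℝ≥0∞) * ENNReal.ofReal m ≤ 1 := by
      rw [← nsmul_eq_mul]
      exact (Finset.card_nsmul_le_sum N _ _ fun c hc => hball c (hND hc)).trans h1
    rw [← ENNReal.ofReal_natCast, ← ENNReal.ofReal_mul (by positivity),
      ENNReal.ofReal_le_one] at h2
    exact h2
  have hbdd : ∀ j, P j → j ≤ ⌊1 / m⌋₊ := fun j hj =>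
    Nat.le_floor ((le_div_iff₀ hmpos).2 (hcard j hj))
  have hP0 : P 0 := ⟨∅, by simp⟩
  have hPmax := Nat.findGreatest_spec (P := P) (Nat.zero_le ⌊1 / m⌋₊) hP0
  obtain ⟨N, hNc, hND, hsep⟩ := id hPmax
  refine ⟨N, hNc ▸ hcard _ hPmax, fun c hc => ?_⟩
  by_contra! hfar
  have hcN : c ∉ N := fun hcN => by have := hfar c hcN; simp at this; linarith
  have hnext : P (N.card + 1) := by
    refine ⟨insert c N, Finset.card_insert_of_notMem hcN, ?_, ?_⟩
    · rw [Finset.coe_insert]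
      exact Set.insert_subset hc hND
    · rw [Finset.coe_insert]
      refine hsep.insert fun b hb _ => ⟨hfar b hb, ?_⟩
      rw [dist_comm]; exact hfar b hb
  have := Nat.le_findGreatest (hbdd _ hnext) hnext
  omega

/-- Balls around a fixed centre attain every probability. -/
lemma exists_law_closedBall_eq (f : E d → ℝ≥0) [IsProbabilityMeasure (law f)] (hd : 0 < d)
    (c : E d) {p : ℝ≥0∞} (hp : p < 1) : ∃ ρ : ℝ, law f (Metric.closedBall c ρ) = p := by
  have : Nonempty (Fin d) := ⟨⟨0, hd⟩⟩
  -- Spheres are null, so the mass is continuous in the radius and the intermediate value theorem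
  -- applies.
  have hcont : Continuous fun ρ : ℝ => law f (Metric.closedBall c ρ) := by
    rw [continuous_iff_continuousAt]
    intro ρ
    refine tendsto_measure_of_ae_tendsto_indicator_of_isFiniteMeasure _ measurableSet_closedBall
      (fun _ => measurableSet_closedBall) ?_
    have hsphere : law f (Metric.sphere c ρ) = 0 :=
      withDensity_absolutelyContinuous _ _ (Measure.addHaar_sphere _ _ _)
    filter_upwards [compl_mem_ae_iff.2 hsphere] with z hz
    rcases lt_or_gt_of_ne (show dist z c ≠ ρ from hz) with h | h
    · filter_upwards [lt_mem_nhds h] with ρ' h'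
      simp [h.le, h'.le]
    · filter_upwards [gt_mem_nhds h] with ρ' h'
      simp [h.not_ge, h'.not_ge]
  refine mem_range_of_exists_le_of_exists_ge hcont ⟨-1, by simp⟩ ?_
  have hlim : Filter.Tendsto (fun m : ℕ => law f (Metric.closedBall c m)) Filter.atTop
      (nhds (law f (⋃ m : ℕ, Metric.closedBall c m))) :=
    tendsto_measure_iUnion_atTop fun a b hab =>
      Metric.closedBall_subset_closedBall (by exact_mod_cast hab)
  rw [Metric.iUnion_closedBall_nat, measure_univ] at hlim
  obtain ⟨m, hm⟩ := (hlim.eventually (lt_mem_nhds hp)).exists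
  exact ⟨m, hm.le⟩

end ClusterTree

/-! ### Chernoff bounds for counts relative to a sample point. -/

namespace ClusterTree

section Tail

variable {α : Type*} [MeasurableSpace α] (μ : Measure α) [IsProbabilityMeasure μ]

lemma lintegral_prod_pair {m : ℕ} (i : Fin (m + 1)) {g : α × α → ℝ≥0∞} (hg : Measurable g) :
    ∫⁻ x : Fin (m + 1) → α, ∏ j : Fin m, g (x i, x (i.succAbove j)) ∂Measure.pi (fun _ => μ) =
      ∫⁻ c, (∫⁻ z, g (c, z) ∂μ) ^ m ∂μ := by
  have hmp := measurePreserving_piFinSuccAbove (fun _ : Fin (m + 1) => μ) i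
  have hG : Measurable fun y : α × (Fin m → α) => ∏ j : Fin m, g (y.1, y.2 j) := by fun_prop
  have := hmp.lintegral_comp hG
  rw [lintegral_prod _ hG.aemeasurable] at this
  refine (Eq.trans ?_ this).trans (lintegral_congr fun c => ?_)
  · rfl
  · have hc : Measurable fun z => g (c, z) := by fun_prop
    have hind := ProbabilityTheory.iIndepFun_pi (μ := fun _ : Fin m => μ)
      (X := fun _ z => g (c, z)) (fun _ => hc.aemeasurable)
    have h1 := ProbabilityTheory.lintegral_prod_eq_prod_lintegral_of_indepFun Finset.univ
      (fun (j : Fin m) (y : Fin m → α) => g (c, y j)) hind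
      (fun j => hc.comp (measurable_pi_apply j))
    refine h1.trans ?_
    have h2 : ∀ j : Fin m, ∫⁻ y : Fin m → α, g (c, y j) ∂Measure.pi (fun _ => μ) =
        ∫⁻ z, g (c, z) ∂μ := fun j =>
      (measurePreserving_eval (fun _ : Fin m => μ) j).lintegral_comp hc
    simp [h2]

open Classical in
/-- The number of sample points other than `x i` that are related to `x i`. -/
noncomputable def relCount {n : ℕ} (R : Set (α × α)) (x : Fin n → α) (i : Fin n) : ℕ :=
  (({i}ᶜ : Finset (Fin n)).filter fun j => (x i, x j) ∈ R).card

/-- Markov's inequality for `w ^ relCount`: given `x i = c`, the other `n - 1` points contribute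
independent factors of mean `1 + (w - 1) μ(R_c)`. Taking `w > 1` or `w < 1` gives the two tails. -/
lemma measure_relCount_le {n : ℕ} (i : Fin n) {R : Set (α × α)} (hR : MeasurableSet R)
    {w M a : ℝ} (hw : 0 < w) (hM : 0 ≤ M) (ha : 0 < a)
    (h : ∀ c, 1 + (w - 1) * μ.real {z | (c, z) ∈ R} ≤ M) :
    Measure.pi (fun _ => μ) {x : Fin n → α | a ≤ w ^ relCount R x i} ≤
      ENNReal.ofReal (M ^ (n - 1) / a) := by
  classical
  obtain ⟨m, rfl⟩ : ∃ m, n = m + 1 := ⟨n - 1, by have := i.pos; omega⟩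
  let g : α × α → ℝ≥0∞ := R.piecewise (fun _ => ENNReal.ofReal w) fun _ => 1
  have hg : Measurable g := Measurable.piecewise hR measurable_const measurable_const
  have hgi : ∀ c, ∫⁻ z, g (c, z) ∂μ ≤ ENNReal.ofReal M := by
    intro c
    have hRc : MeasurableSet {z | (c, z) ∈ R} := measurable_prodMk_left hR
    have e : (fun z => g (c, z)) =
        {z | (c, z) ∈ R}.piecewise (fun _ => ENNReal.ofReal w) fun _ => 1 := by
      ext z; simp [g, Set.piecewise]
    rw [e, ← lintegral_add_compl _ hRc,
      setLIntegral_congr_fun hRc (g := fun _ => ENNReal.ofReal w)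
        (fun z hz => Set.piecewise_eq_of_mem _ _ _ hz),
      setLIntegral_congr_fun hRc.compl (g := fun _ => 1)
        (fun z hz => Set.piecewise_eq_of_notMem _ _ _ hz),
      setLIntegral_const, setLIntegral_const, one_mul,
      ← ofReal_measureReal, ← ofReal_measureReal (s := {z | (c, z) ∈ R}ᶜ),
      ← ENNReal.ofReal_mul hw.le, ← ENNReal.ofReal_add (by positivity) (by positivity),
      probReal_compl_eq_one_sub hRc]
    exact ENNReal.ofReal_le_ofReal (by linarith [h c])
  have hprod : ∀ x : Fin (m + 1) → α,
      ∏ j : Fin m, g (x i, x (i.succAbove j)) = ENNReal.ofReal (w ^ relCount R x i) := by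
    intro x
    rw [← Finset.prod_image (s := Finset.univ) (g := i.succAbove) (f := fun j => g (x i, x j))
      (fun a _ b _ hab => Fin.succAbove_right_injective hab), Fin.image_succAbove_univ]
    simp only [g, Set.piecewise]
    rw [Finset.prod_ite, ENNReal.ofReal_pow hw.le]
    simp [relCount]
  have hmarkov := meas_ge_le_lintegral_div (μ := Measure.pi (fun _ : Fin (m + 1) => μ))
    (f := fun x => ∏ j : Fin m, g (x i, x (i.succAbove j)))
    (Measurable.aemeasurable (by fun_prop)) (ε := ENNReal.ofReal a)
    (by simpa using ha) ENNReal.ofReal_ne_top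
  rw [lintegral_prod_pair μ i hg] at hmarkov
  refine le_trans (measure_mono fun x hx => ?_) (hmarkov.trans ?_)
  · change ENNReal.ofReal a ≤ _
    rw [hprod]
    exact ENNReal.ofReal_le_ofReal hx
  · rw [ENNReal.ofReal_div_of_pos ha, ENNReal.ofReal_pow hM]
    gcongr
    calc ∫⁻ c, (∫⁻ z, g (c, z) ∂μ) ^ m ∂μ ≤ ∫⁻ _, (ENNReal.ofReal M) ^ m ∂μ :=
          lintegral_mono fun c => pow_le_pow_left' (hgi c) m
      _ = _ := by simp

lemma measure_relCount_ge_le {n k : ℕ} (i : Fin n) {R : Set (α × α)} (hR : MeasurableSet R)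
    {p t : ℝ} (hp : 0 ≤ p) (ht : 0 ≤ t) (h : ∀ c, μ.real {z | (c, z) ∈ R} ≤ p) :
    Measure.pi (fun _ => μ) {x : Fin n → α | k ≤ relCount R x i + 1} ≤
      ENNReal.ofReal (Real.exp (t + n * p * (Real.exp t - 1) - t * k)) := by
  have ht1 : 0 ≤ Real.exp t - 1 := by linarith [Real.one_le_exp ht]
  have hn : (1 : ℝ) ≤ n := by exact_mod_cast i.pos
  refine le_trans (measure_mono fun x hx => ?_) ((measure_relCount_le μ i hR
    (w := Real.exp t) (M := Real.exp (p * (Real.exp t - 1))) (a := Real.exp (t * (k - 1)))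
    (Real.exp_pos _) (Real.exp_pos _).le (Real.exp_pos _) fun c => ?_).trans ?_)
  · change Real.exp _ ≤ _
    rw [← Real.exp_nat_mul, Real.exp_le_exp]
    have : (k : ℝ) ≤ relCount R x i + 1 := by exact_mod_cast hx
    nlinarith
  · have := Real.add_one_le_exp (p * (Real.exp t - 1))
    nlinarith [h c]
  · refine ENNReal.ofReal_le_ofReal ?_
    rw [← Real.exp_nat_mul, ← Real.exp_sub, Real.exp_le_exp, Nat.cast_sub i.pos]
    have : 0 ≤ p * (Real.exp t - 1) := by positivity
    push_cast
    nlinarith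

lemma measure_relCount_lt_le {n k : ℕ} (i : Fin n) {R : Set (α × α)} (hR : MeasurableSet R)
    {p t : ℝ} (hp1 : p ≤ 1) (ht : 0 ≤ t) (h : ∀ c, p ≤ μ.real {z | (c, z) ∈ R}) :
    Measure.pi (fun _ => μ) {x : Fin n → α | relCount R x i + 1 < k} ≤
      ENNReal.ofReal (Real.exp (t * k - n * p * (1 - Real.exp (-t)))) := by
  have ht1 : 0 ≤ 1 - Real.exp (-t) := by
    linarith [Real.exp_le_one_iff.2 (neg_nonpos.2 ht)]
  refine le_trans (measure_mono fun x hx => ?_) ((measure_relCount_le μ i hR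
    (w := Real.exp (-t)) (M := Real.exp (-(p * (1 - Real.exp (-t)))))
    (a := Real.exp (-(t * (k - 1))))
    (Real.exp_pos _) (Real.exp_pos _).le (Real.exp_pos _) fun c => ?_).trans ?_)
  · change Real.exp _ ≤ _
    rw [← Real.exp_nat_mul, Real.exp_le_exp]
    have : (relCount R x i : ℝ) + 1 ≤ k := by exact_mod_cast (Nat.le_of_lt hx)
    nlinarith
  · have := Real.add_one_le_exp (-(p * (1 - Real.exp (-t))))
    nlinarith [h c]
  · refine ENNReal.ofReal_le_ofReal ?_
    rw [← Real.exp_nat_mul, ← Real.exp_sub, Real.exp_le_exp, Nat.cast_sub i.pos]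
    -- Replacing `n - 1` by `n` costs `p * (1 - exp (-t)) ≤ t`, which the threshold `k - 1` (the
    -- centre counts itself) pays for.
    have h2 := Real.add_one_le_exp (-t)
    have h3 : p * (1 - Real.exp (-t)) ≤ 1 * (1 - Real.exp (-t)) := by gcongr
    push_cast
    nlinarith

end Tail

end ClusterTree

/-! ### Concentration of ball counts, and empty sets in a finite family. -/

namespace ClusterTree

variable {d : ℕ}

/-- The probability of the closed ball around `y.1` whose boundary contains `y.2`. -/
noncomputable def rankProb (f : E d → ℝ≥0) (y : E d × E d) : ℝ≥0∞ :=
  law f (Metric.closedBall y.1 (dist y.2 y.1))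

lemma measurable_rankProb (f : E d → ℝ≥0) [IsProbabilityMeasure (law f)] :
    Measurable (rankProb f) := by
  have hs : MeasurableSet {q : (E d × E d) × E d | dist q.2 q.1.1 ≤ dist q.1.2 q.1.1} :=
    (isClosed_le (by fun_prop) (by fun_prop)).measurableSet
  exact measurable_measure_prodMk_left hs

/-- All points of the ball around `c` of mass exactly `p` have rank at most `p`. -/
lemma le_law_rankProb_le (f : E d → ℝ≥0) [IsProbabilityMeasure (law f)] (hd : 0 < d)
    (c : E d) {p : ℝ} (hp0 : 0 ≤ p) (hp : p < 1) :
    p ≤ (law f).real {z | (c, z) ∈ {y | rankProb f y ≤ ENNReal.ofReal p}} := by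
  obtain ⟨ρ, hρ⟩ := exists_law_closedBall_eq f hd c (p := ENNReal.ofReal p) (by simpa using hp)
  have hsub : Metric.closedBall c ρ ⊆ {z | (c, z) ∈ {y | rankProb f y ≤ ENNReal.ofReal p}} :=
    fun z hz => (measure_mono (Metric.closedBall_subset_closedBall hz)).trans_eq hρ
  have := measureReal_mono (μ := law f) hsub
  rwa [measureReal_def, hρ, ENNReal.toReal_ofReal hp0] at this

lemma law_rankProb_lt_le (f : E d → ℝ≥0) [IsProbabilityMeasure (law f)] (hd : 0 < d)
    (c : E d) {p : ℝ} (hp0 : 0 ≤ p) (hp : p < 1) :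
    (law f).real {z | (c, z) ∈ {y | rankProb f y < ENNReal.ofReal p}} ≤ p := by
  obtain ⟨ρ, hρ⟩ := exists_law_closedBall_eq f hd c (p := ENNReal.ofReal p) (by simpa using hp)
  have hsub : {z | (c, z) ∈ {y | rankProb f y < ENNReal.ofReal p}} ⊆ Metric.closedBall c ρ := by
    intro z hz
    by_contra hcon
    rw [Metric.mem_closedBall, not_le] at hcon
    refine absurd (show rankProb f (c, z) < ENNReal.ofReal p from hz) (not_lt.2 ?_)
    rw [← hρ]
    exact measure_mono (Metric.closedBall_subset_closedBall hcon.le)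
  have := measureReal_mono (μ := law f) hsub
  rwa [measureReal_def (s := Metric.closedBall c ρ), hρ, ENNReal.toReal_ofReal hp0] at this

lemma relCount_add_one_eq_ncard {n : ℕ} (R : Set (E d × E d)) (x : Fin n → E d) (i : Fin n) :
    relCount R x i + 1 = (insert i {j | j ≠ i ∧ (x i, x j) ∈ R}).ncard := by
  classical
  rw [Set.ncard_insert_of_notMem (by simp), relCount, ← Set.ncard_coe_finset]
  congr 2
  ext j
  simp

/-- A point outside the ball has rank at least the mass of the ball. The relation does not depend on
`ρ`, so a bound on its count serves all radii. -/
lemma relCount_add_one_le_ncard {n : ℕ} (f : E d → ℝ≥0) (x : Fin n → E d) (i : Fin n) {ρ : ℝ}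
    (hρ : 0 ≤ ρ) {p : ℝ≥0∞} (hp : p < law f (Metric.closedBall (x i) ρ)) :
    relCount {y | rankProb f y ≤ p} x i + 1 ≤ {j | x j ∈ Metric.closedBall (x i) ρ}.ncard := by
  rw [relCount_add_one_eq_ncard]
  refine Set.ncard_le_ncard (Set.insert_subset (by simpa using hρ) fun j hj => ?_)
  by_contra hcon
  rw [Set.mem_ofPred_eq, Metric.mem_closedBall, not_le] at hcon
  exact absurd (hj.2 : rankProb f _ ≤ p)
    (not_le.2 (hp.trans_le (measure_mono (Metric.closedBall_subset_closedBall hcon.le))))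

lemma ncard_le_relCount_add_one {n : ℕ} (f : E d → ℝ≥0) (x : Fin n → E d) (i : Fin n) {ρ : ℝ}
    {p : ℝ≥0∞} (hp : law f (Metric.closedBall (x i) ρ) < p) :
    {j | x j ∈ Metric.closedBall (x i) ρ}.ncard ≤ relCount {y | rankProb f y < p} x i + 1 := by
  rw [relCount_add_one_eq_ncard]
  refine Set.ncard_le_ncard fun j hj => ?_
  by_cases hij : j = i
  · exact Or.inl hij
  · exact Or.inr ⟨hij,
      (measure_mono (Metric.closedBall_subset_closedBall hj)).trans_lt hp⟩

/-- With high probability, every ball around a sample point with a little more than the expected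
mass contains `k` sample points. -/
lemma measure_exists_ball_few_le (f : E d → ℝ≥0) [IsProbabilityMeasure (law f)] (hd : 0 < d)
    {n k : ℕ} {ε : ℝ} (hk : 0 < k) (hε0 : 0 < ε) (hε1 : ε < 1) (hkn : k * (1 + ε / 2) ≤ n) :
    sampleLaw f n {x | ∃ i, ∃ ρ : ℝ,
        ENNReal.ofReal (k / n * (1 + ε / 2)) ≤ law f (Metric.closedBall (x i) ρ) ∧
        {j | x j ∈ Metric.closedBall (x i) ρ}.ncard < k} ≤
      ENNReal.ofReal (n * Real.exp (-(k * ε ^ 2 / 48))) := by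
  have hk' : (0 : ℝ) < k := by exact_mod_cast hk
  have hn : (0 : ℝ) < n := lt_of_lt_of_le (by positivity) hkn
  -- `ε / 3` in place of `ε / 2` leaves room for a strict inequality of masses.
  set p : ℝ := k / n * (1 + ε / 3) with hp
  have hpp : p < k / n * (1 + ε / 2) := by
    have : 0 < (k : ℝ) / n := by positivity
    rw [hp]; nlinarith
  have hp1 : p < 1 := by
    refine hpp.trans_le ?_
    rw [div_mul_eq_mul_div, div_le_one hn]; exact hkn
  have hp0 : 0 ≤ p := by positivity
  set R : Set (E d × E d) := {y | rankProb f y ≤ ENNReal.ofReal p} with hR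
  have hRm : MeasurableSet R := measurableSet_le (measurable_rankProb f) measurable_const
  have hi : ∀ i : Fin n, sampleLaw f n {x | relCount R x i + 1 < k} ≤
      ENNReal.ofReal (Real.exp (-(k * ε ^ 2 / 48))) := by
    intro i
    refine (measure_relCount_lt_le (law f) i hRm hp1.le (t := ε / 8) (by positivity)
      fun c => le_law_rankProb_le f hd c hp0 hp1).trans (ENNReal.ofReal_le_ofReal ?_)
    rw [Real.exp_le_exp]
    have hb := (abs_le.1 (Real.abs_exp_sub_one_sub_id_le (x := -(ε / 8))
      (by rw [abs_neg, abs_of_pos (by positivity)]; linarith))).2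
    have hnp : n * p = k * (1 + ε / 3) := by rw [hp]; field_simp
    rw [hnp]
    have h1 : k * (1 + ε / 3) * (ε / 8 - (ε / 8) ^ 2) ≤
        k * (1 + ε / 3) * (1 - Real.exp (-(ε / 8))) := by
      refine mul_le_mul_of_nonneg_left ?_ (by positivity)
      nlinarith
    -- The left factor is `-5ε²/192 + ε³/192`, so `ε < 1` gives exactly `1/48`.
    have h2 : k * (ε / 8 - (1 + ε / 3) * (ε / 8 - (ε / 8) ^ 2)) ≤ k * (-(ε ^ 2 / 48)) := by
      gcongr
      nlinarith [pow_pos hε0 2, pow_pos hε0 3]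
    nlinarith
  have hsub : {x : Fin n → E d | ∃ i, ∃ ρ : ℝ,
        ENNReal.ofReal (k / n * (1 + ε / 2)) ≤ law f (Metric.closedBall (x i) ρ) ∧
        {j | x j ∈ Metric.closedBall (x i) ρ}.ncard < k} ⊆
      ⋃ i : Fin n, {x | relCount R x i + 1 < k} := by
    rintro x ⟨i, ρ, h1, h2⟩
    have hlt : ENNReal.ofReal p < law f (Metric.closedBall (x i) ρ) :=
      lt_of_lt_of_le ((ENNReal.ofReal_lt_ofReal_iff (by positivity)).2 hpp) h1
    have hρ : 0 ≤ ρ := by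
      by_contra hneg
      rw [Metric.closedBall_eq_empty.2 (not_le.1 hneg), measure_empty] at hlt
      exact not_lt_zero hlt
    exact Set.mem_iUnion.2 ⟨i, (relCount_add_one_le_ncard f x i hρ hlt).trans_lt h2⟩
  refine (measure_mono hsub).trans ((measure_iUnion_fintype_le _ _).trans
    ((Finset.sum_le_sum fun i _ => hi i).trans_eq ?_))
  rw [Finset.sum_const, Finset.card_univ, Fintype.card_fin, nsmul_eq_mul,
    ENNReal.ofReal_mul hn.le, ENNReal.ofReal_natCast]

/-- With high probability, every ball around a sample point with a little less than the expected
mass contains fewer than `k` sample points. -/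
lemma measure_exists_ball_many_le (f : E d → ℝ≥0) [IsProbabilityMeasure (law f)] (hd : 0 < d)
    {n k : ℕ} {ε : ℝ} (hk : 0 < k) (hε0 : 0 < ε) (hε1 : ε < 1) (hkn : k ≤ n) :
    sampleLaw f n {x | ∃ i, ∃ ρ : ℝ,
        law f (Metric.closedBall (x i) ρ) ≤ ENNReal.ofReal (k / n * (1 - ε / 2)) ∧
        k ≤ {j | x j ∈ Metric.closedBall (x i) ρ}.ncard} ≤
      ENNReal.ofReal (n * Real.exp (1 - k * ε ^ 2 / 48)) := by
  have hk' : (0 : ℝ) < k := by exact_mod_cast hk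
  have hkn' : (k : ℝ) ≤ n := by exact_mod_cast hkn
  have hn : (0 : ℝ) < n := hk'.trans_le hkn'
  set p : ℝ := k / n * (1 - ε / 3) with hp
  have hpos : 0 < (k : ℝ) / n := by positivity
  have hle : (k : ℝ) / n ≤ 1 := (div_le_one hn).2 hkn'
  have hpp : k / n * (1 - ε / 2) < p := by
    rw [hp]; nlinarith
  have hp1 : p < 1 := by
    rw [hp]; nlinarith
  have hp0 : 0 < p := mul_pos hpos (by linarith)
  set R : Set (E d × E d) := {y | rankProb f y < ENNReal.ofReal p} with hR
  have hRm : MeasurableSet R := measurableSet_lt (measurable_rankProb f) measurable_const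
  have hi : ∀ i : Fin n, sampleLaw f n {x | k ≤ relCount R x i + 1} ≤
      ENNReal.ofReal (Real.exp (1 - k * ε ^ 2 / 48)) := by
    intro i
    refine (measure_relCount_ge_le (law f) i hRm hp0.le (t := ε / 6) (by positivity)
      fun c => law_rankProb_lt_le f hd c hp0.le hp1).trans (ENNReal.ofReal_le_ofReal ?_)
    rw [Real.exp_le_exp]
    have hb := (abs_le.1 (Real.abs_exp_sub_one_sub_id_le (x := ε / 6)
      (by rw [abs_of_pos (by positivity)]; linarith))).2
    have hnp : n * p = k * (1 - ε / 3) := by rw [hp]; field_simp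
    rw [hnp]
    have h0 : 0 ≤ (k : ℝ) * (1 - ε / 3) := mul_nonneg hk'.le (by linarith)
    have h1 : k * (1 - ε / 3) * (Real.exp (ε / 6) - 1) ≤
        k * (1 - ε / 3) * (ε / 6 + (ε / 6) ^ 2) := by
      gcongr
      linarith
    have h2 : k * ((1 - ε / 3) * (ε / 6 + (ε / 6) ^ 2) - ε / 6) ≤ k * (-(ε ^ 2 / 48)) := by
      gcongr
      nlinarith [pow_pos hε0 2, pow_pos hε0 3]
    nlinarith
  have hsub : {x : Fin n → E d | ∃ i, ∃ ρ : ℝ,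
        law f (Metric.closedBall (x i) ρ) ≤ ENNReal.ofReal (k / n * (1 - ε / 2)) ∧
        k ≤ {j | x j ∈ Metric.closedBall (x i) ρ}.ncard} ⊆
      ⋃ i : Fin n, {x | k ≤ relCount R x i + 1} := by
    rintro x ⟨i, ρ, h1, h2⟩
    have hlt : law f (Metric.closedBall (x i) ρ) < ENNReal.ofReal p :=
      lt_of_le_of_lt h1 ((ENNReal.ofReal_lt_ofReal_iff hp0).2 hpp)
    exact Set.mem_iUnion.2 ⟨i, h2.trans (ncard_le_relCount_add_one f x i hlt)⟩
  refine (measure_mono hsub).trans ((measure_iUnion_fintype_le _ _).trans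
    ((Finset.sum_le_sum fun i _ => hi i).trans_eq ?_))
  rw [Finset.sum_const, Finset.card_univ, Fintype.card_fin, nsmul_eq_mul,
    ENNReal.ofReal_mul hn.le, ENNReal.ofReal_natCast]

/-- The union bound over pairs of a finite net for the event that a set of probability at least
`p` contains no sample point. -/
lemma measure_exists_pair_empty_le (f : E d → ℝ≥0) [IsProbabilityMeasure (law f)]
    (N : Finset (E d)) (g : E d → E d → Set (E d)) (hg : ∀ a b, MeasurableSet (g a b)) (n : ℕ)
    (p : ℝ) :
    sampleLaw f n {x | ∃ a ∈ N, ∃ b ∈ N, p ≤ (law f).real (g a b) ∧ ∀ j, x j ∉ g a b} ≤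
      ENNReal.ofReal ((N.card : ℝ) ^ 2 * Real.exp (-(n * p))) := by
  classical
  let T := (N ×ˢ N).filter fun q => p ≤ (law f).real (g q.1 q.2)
  have hsub : {x : Fin n → E d | ∃ a ∈ N, ∃ b ∈ N, p ≤ (law f).real (g a b) ∧
      ∀ j, x j ∉ g a b} ⊆ ⋃ q ∈ T, {x | ∀ j, x j ∉ g q.1 q.2} := by
    rintro x ⟨a, ha, b, hb, hp, hx⟩
    exact Set.mem_biUnion (x := (a, b)) (by simp [T, ha, hb, hp]) hx
  have hT : ∀ q ∈ T, sampleLaw f n {x | ∀ j, x j ∉ g q.1 q.2} ≤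
      ENNReal.ofReal (Real.exp (-(n * p))) := by
    intro q hq
    have hq2 : p ≤ (law f).real (g q.1 q.2) := (Finset.mem_filter.1 hq).2
    have e : {x : Fin n → E d | ∀ j, x j ∉ g q.1 q.2} =
        Set.univ.pi fun _ => (g q.1 q.2)ᶜ := by
      ext x; simp
    rw [e, sampleLaw, Measure.pi_pi, Finset.prod_const, Finset.card_univ, Fintype.card_fin,
      ← ofReal_measureReal, ← ENNReal.ofReal_pow measureReal_nonneg,
      show -(n * p) = n * (-p) by ring, Real.exp_nat_mul]
    refine ENNReal.ofReal_le_ofReal (pow_le_pow_left₀ measureReal_nonneg ?_ n)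
    rw [probReal_compl_eq_one_sub (hg _ _)]
    linarith [Real.add_one_le_exp (-p)]
  refine (measure_mono hsub).trans ((measure_biUnion_finset_le _ _).trans
    ((Finset.sum_le_sum hT).trans ?_))
  rw [Finset.sum_const, nsmul_eq_mul, ← ENNReal.ofReal_natCast,
    ← ENNReal.ofReal_mul (by positivity)]
  refine ENNReal.ofReal_le_ofReal ?_
  gcongr
  have : T.card ≤ N.card ^ 2 := by
    rw [sq, ← Finset.card_product]; exact Finset.card_filter_le _ _
  exact_mod_cast this

lemma measure_exists_density_eq_zero {f : E d → ℝ≥0} [IsProbabilityMeasure (law f)]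
    (hf : Measurable f) (n : ℕ) :
    sampleLaw f n {x | ∃ i, f (x i) = 0} = 0 := by
  rw [Set.ofPred_exists, measure_iUnion_null_iff]
  intro i
  have hs : MeasurableSet {z | f z = 0} := hf (measurableSet_singleton 0)
  have := (measurePreserving_eval (fun _ : Fin n => law f) i).measure_preimage
    hs.nullMeasurableSet
  refine this.trans ?_
  rw [law, withDensity_apply _ hs, setLIntegral_congr_fun hs (g := fun _ => 0)]
  · simp
  · intro z hz
    simpa using hz

end ClusterTree

/-! ### Deterministic graph arguments. -/

namespace ClusterTree

variable {d n k : ℕ} {x : Fin n → E d}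

lemma knnRadius_le {i : Fin n} {r : ℝ≥0}
    (h : k ≤ {j | x j ∈ Metric.closedBall (x i) (r : ℝ)}.ncard) : knnRadius x k i ≤ r :=
  iInf₂_le r h

lemma le_knnRadius {i : Fin n} {r : ℝ≥0}
    (h : {j | x j ∈ Metric.closedBall (x i) (r : ℝ)}.ncard < k) : r ≤ knnRadius x k i := by
  refine le_iInf₂ fun r' hr' => ?_
  by_contra hlt
  have hlt : r' < r := by simpa using hlt
  refine absurd (hr'.trans (Set.ncard_le_ncard fun j hj => ?_)) (not_le.2 h)
  exact Metric.closedBall_subset_closedBall (NNReal.coe_le_coe.2 hlt.le) hj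

/-- There are finitely many data points, so the count does not change on a short interval to the
right of `r`. -/
lemma lt_knnRadius {i : Fin n} {r : ℝ≥0}
    (h : {j | x j ∈ Metric.closedBall (x i) (r : ℝ)}.ncard < k) : r < knnRadius x k i := by
  have hev : ∀ᶠ r' : ℝ≥0 in nhdsWithin r (Set.Ioi r),
      ∀ j, dist (x j) (x i) ≤ r' → dist (x j) (x i) ≤ r := by
    rw [Filter.eventually_all]
    intro j
    by_cases hj : dist (x j) (x i) ≤ r
    · exact Filter.Eventually.of_forall fun _ _ => hj
    · have : r < nndist (x j) (x i) := by
        rw [not_le] at hj; exact_mod_cast hj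
      filter_upwards [nhdsWithin_le_nhds (gt_mem_nhds this)] with r' hr' hcon
      exact absurd hcon (not_le.2 (by exact_mod_cast hr'))
  obtain ⟨r', hr', hlt⟩ := (hev.and self_mem_nhdsWithin).exists
  refine (ENNReal.coe_lt_coe.2 hlt).trans_le (le_knnRadius (lt_of_le_of_lt ?_ h))
  exact Set.ncard_le_ncard fun j hj => hr' j hj

lemma disconnectedIn_nnGraph {v : Variant} {α σ : ℝ} {r : ℝ≥0} {X S A A' : Set (E d)}
    (hα : α ≤ 2) (hX : ∀ i, x i ∈ X) (hconv : ConvexAtScale X σ) (hr : 2 * (r : ℝ) ≤ σ)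
    (hS : ∀ a ∈ A, ∀ a' ∈ A', ∀ γ : Path a a', (∀ t, γ t ∈ X) → ∃ t, γ t ∈ S)
    (hnear : ∀ i, ∀ s ∈ S, dist (x i) s ≤ r → r < knnRadius x k i) :
    DisconnectedIn x (nnGraph v α k x r) A A' := by
  have hfar : ∀ i : nodes x k r, ∀ s ∈ S, (r : ℝ) < dist (x i) s := fun i s hs => by
    by_contra! hcon
    exact absurd (i.2 : knnRadius x k i ≤ r) (not_le.2 (hnear i s hs hcon))
  have hmem : ∀ i : nodes x k r, x i ∈ X \ S := fun i =>
    ⟨hX i, fun hs => absurd (hfar i _ hs) (by simp)⟩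
  have hseg : ∀ i j : nodes x k r, edist (x i) (x j) ≤
      ENNReal.ofReal α * v.scale (knnRadius x k i) (knnRadius x k j) →
      JoinedIn (X \ S) (x i) (x j) := by
    intro i j hij
    have hscale : v.scale (knnRadius x k i) (knnRadius x k j) ≤ r := by
      cases v
      · exact max_le i.2 j.2
      · exact (min_le_left _ _).trans i.2
    have hdist : dist (x i) (x j) ≤ 2 * r := by
      have h1 : edist (x i) (x j) ≤ ENNReal.ofReal (2 * r) := by
        refine hij.trans ?_
        rw [ENNReal.ofReal_mul two_pos.le, ENNReal.ofReal_coe_nnreal]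
        gcongr
      rw [edist_dist] at h1
      exact (ENNReal.ofReal_le_ofReal_iff (by positivity)).1 h1
    refine JoinedIn.of_segment_subset fun y hy =>
      ⟨hconv _ (hX i) _ (hX j) (hdist.trans hr) hy, fun hyS => ?_⟩
    have h1 := hfar i y hyS
    have h2 := hfar j y hyS
    have h3 := dist_add_dist_of_mem_segment hy
    rw [dist_comm y (x j)] at h3
    linarith
  have hreach : ∀ i j : nodes x k r, (nnGraph v α k x r).Reachable i j →
      JoinedIn (X \ S) (x i) (x j) := by
    rintro i j ⟨w⟩
    induction w with
    | nil => exact JoinedIn.refl (hmem _)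
    | cons hadj _ ih =>
      refine JoinedIn.trans ?_ ih
      rw [nnGraph, SimpleGraph.fromRel_adj] at hadj
      rcases hadj.2 with h | h
      · exact hseg _ _ h
      · exact (hseg _ _ h).symm
  intro i j hi hj hij
  obtain ⟨γ, hγ⟩ := hreach i j hij
  obtain ⟨t, ht⟩ := hS _ hi _ hj γ fun t => (hγ t).1
  exact (hγ t).2 ht

/-- The points of `A` within `s` of the component of `x i` form a clopen subset of `A`: closed as a
finite union of closed sets, open because `hstep` supplies a neighbour strictly closer than `s`. -/
lemma connectedIn_nnGraph {v : Variant} {α s r₀ : ℝ} {r : ℝ≥0} {A : Set (E d)}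
    (hα : √2 ≤ α) (hs₀ : 0 ≤ s) (hs : s ≤ √2 * r₀) (hA : IsPreconnected A)
    (hnode : ∀ a ∈ A, ∀ i, dist (x i) a ≤ s → i ∈ nodes x k r)
    (hrad : ∀ i, ENNReal.ofReal r₀ ≤ knnRadius x k i)
    (hstep : ∀ a ∈ A, ∀ i, dist (x i) a ≤ s →
      ∃ j, dist (x j) a < s ∧ dist (x i) (x j) ≤ √2 * r₀) :
    ConnectedIn x (nnGraph v α k x r) A := by
  have hedge : ∀ i j : nodes x k r, dist (x i) (x j) ≤ √2 * r₀ →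
      (nnGraph v α k x r).Reachable i j := by
    intro i j hij
    by_cases h : i = j
    · exact h ▸ SimpleGraph.Reachable.refl _
    · refine SimpleGraph.Adj.reachable ?_
      rw [nnGraph, SimpleGraph.fromRel_adj]
      refine ⟨h, Or.inl ?_⟩
      have hscale : ENNReal.ofReal r₀ ≤ v.scale (knnRadius x k i) (knnRadius x k j) := by
        cases v
        · exact (hrad i).trans (le_max_left _ _)
        · exact le_min (hrad i) (hrad j)
      rw [edist_dist]
      calc ENNReal.ofReal (dist (x i) (x j)) ≤ ENNReal.ofReal (√2 * r₀) :=
            ENNReal.ofReal_le_ofReal hij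
        _ = ENNReal.ofReal (√2) * ENNReal.ofReal r₀ := ENNReal.ofReal_mul (Real.sqrt_nonneg _)
        _ ≤ _ := by gcongr
  intro i j hi hj
  have hiV : i ∈ nodes x k r := hnode _ hi i (by simpa using hs₀)
  have hjV : j ∈ nodes x k r := hnode _ hj j (by simpa using hs₀)
  refine ⟨hiV, hjV, ?_⟩
  let T : Set A := {a | ∃ q : nodes x k r, (nnGraph v α k x r).Reachable ⟨i, hiV⟩ q ∧
    dist (x q) a ≤ s}
  have hclosed : IsClosed T := by
    have : T = ⋃ q ∈ {q | (nnGraph v α k x r).Reachable ⟨i, hiV⟩ q},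
        {a : A | dist (x q) a ≤ s} := by
      ext a; simp [T]
    rw [this]
    exact Set.Finite.isClosed_biUnion (Set.toFinite _) fun q _ =>
      isClosed_le (by fun_prop) continuous_const
  have hopen : IsOpen T := by
    rw [isOpen_iff_mem_nhds]
    rintro a ⟨q, hq, hqa⟩
    obtain ⟨q', hq', hqq'⟩ := hstep a a.2 q hqa
    have hV : q' ∈ nodes x k r := hnode a a.2 q' hq'.le
    have hcont : Continuous fun b : A => dist (x q') b := by fun_prop
    filter_upwards [hcont.continuousAt.eventually (gt_mem_nhds hq')] with b hb
    exact ⟨⟨q', hV⟩, hq.trans (hedge _ _ hqq'), hb.le⟩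
  have : PreconnectedSpace A := Subtype.preconnectedSpace hA
  have huniv : T = Set.univ := IsClopen.eq_univ ⟨hclosed, hopen⟩
    ⟨⟨x i, hi⟩, ⟨i, hiV⟩, SimpleGraph.Reachable.refl _, by simpa using hs₀⟩
  obtain ⟨q, hq, hqj⟩ : (⟨x j, hj⟩ : A) ∈ T := huniv ▸ Set.mem_univ _
  exact hq.trans (hedge q ⟨j, hjV⟩ (hqj.trans hs))

/-- Law of cosines: in the half facing `q`, the cross term only shortens the distance to `q`. -/
lemma half_ball_subset_closedBall {p q : E d} {R T : ℝ} (hT : 0 ≤ T)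
    (h : R ^ 2 + dist p q ^ 2 ≤ T ^ 2) :
    Metric.closedBall p R ∩ {z | 0 ≤ inner ℝ (z - p) (q - p)} ⊆ Metric.closedBall q T := by
  rintro z ⟨hz, hz'⟩
  rw [Metric.mem_closedBall, dist_eq_norm] at *
  have h1 := norm_sub_sq_real (z - p) (q - p)
  rw [sub_sub_sub_cancel_right] at h1
  rw [norm_sub_rev] at h
  refine abs_le_of_sq_le_sq' ?_ hT |>.2
  have : ‖z - p‖ ^ 2 ≤ R ^ 2 := by gcongr
  have hz' : 0 ≤ inner ℝ (z - p) (q - p) := hz'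
  linarith

end ClusterTree

/-! ### Lenses containing sample points, and numerical estimates. -/

namespace ClusterTree

variable {d : ℕ}

/-- With high probability, in the region where the density is at least `l`, every point `b` close
to `a` has a sample point within distance `√2 * r₀` which is strictly closer to `a` than the
allowed distance. -/
lemma measure_exists_gap_le (f : E d → ℝ≥0) [IsProbabilityMeasure (law f)] (hd : 0 < d)
    {l r₀ : ℝ} (hl : 0 < l) (hr₀ : 0 < r₀) (n : ℕ) :
    sampleLaw f n {x | ∃ a b : E d, (∀ z ∈ Metric.closedBall a (2 * r₀), l ≤ f z) ∧
        dist b a ≤ (1 - 3 / (10 * d)) * r₀ ∧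
        ∀ j, dist (x j) a < (1 - 3 / (10 * d)) * r₀ → √2 * r₀ < dist b (x j)} ≤
      ENNReal.ofReal (((20 * d) ^ d / (l * (unitBallVolume d * r₀ ^ d))) ^ 2 *
        Real.exp (-(n * (l * (unitBallVolume d * r₀ ^ d) / 4)))) := by
  have hV := unitBallVolume_pos (d := d)
  have hd' : (1 : ℝ) ≤ d := by exact_mod_cast hd
  -- The net has mesh `η * r₀`; by Bernoulli, shrinking the radius by `1 - 5 * η` keeps half of the
  -- volume.
  set η : ℝ := 1 / (10 * d) with hη
  have hη0 : 0 < η := by positivity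
  have hη1 : η ≤ 1 / 10 := by
    rw [hη, div_le_div_iff₀ (by positivity) (by norm_num)]; linarith
  have h3η : (3 : ℝ) / (10 * d) = 3 * η := by rw [hη]; ring
  rw [h3η]
  set m : ℝ := l * (unitBallVolume d * r₀ ^ d) with hm
  have hmpos : 0 < m := by positivity
  obtain ⟨N, hNcard, hN⟩ := exists_finite_net f hl (h := η * r₀) (by positivity)
  have hsq2 := Real.sq_sqrt (show (0 : ℝ) ≤ 2 by norm_num)
  have hs1 : 1 ≤ √2 := Real.one_le_sqrt.2 (by norm_num)
  have hs2 : √2 ≤ 2 := Real.sqrt_le_iff.2 (by norm_num)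
  -- The radii leave slack for replacing `a`, `b` by net points: adding `η * r₀` gives `(1 - 4η) r₀
  -- < (1 - 3η) r₀` and `√2 r₀`.
  let g : E d → E d → Set (E d) := fun a b =>
    Metric.closedBall a ((1 - 5 * η) * r₀) ∩ Metric.closedBall b ((√2 - η) * r₀)
  have hmeas : ∀ a b, MeasurableSet (g a b) := fun a b =>
    measurableSet_closedBall.inter measurableSet_closedBall
  refine le_trans (measure_mono ?_) ((measure_exists_pair_empty_le f N g hmeas n (m / 4)).trans
    (ENNReal.ofReal_le_ofReal ?_))
  · rintro x ⟨a, b, hf, hba, hgap⟩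
    have hηr : η * r₀ ≤ 1 / 10 * r₀ := by gcongr
    have hηr0 : 0 < η * r₀ := by positivity
    obtain ⟨a', ha'N, ha'⟩ := hN a fun z hz => hf z
      (Metric.closedBall_subset_closedBall (by linarith) hz)
    obtain ⟨b', hb'N, hb'⟩ := hN b fun z hz => hf z
      (Metric.closedBall_subset_closedBall' (by linarith) hz)
    have hab' : dist a' b' ≤ (1 - η) * r₀ := by
      have := dist_triangle4 a' a b b'
      rw [dist_comm a' a, dist_comm a b] at this
      linarith
    refine ⟨a', ha'N, b', hb'N, ?_, fun j hj => ?_⟩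
    · have hR : 0 ≤ (1 - 5 * η) * r₀ := mul_nonneg (by linarith) hr₀.le
      have hhalf : Metric.closedBall a' ((1 - 5 * η) * r₀) ∩
          {z | 0 ≤ inner ℝ (z - a') (b' - a')} ⊆ g a' b' := by
        refine Set.subset_inter Set.inter_subset_left
          (half_ball_subset_closedBall (mul_nonneg (by linarith) hr₀.le) ?_)
        have h1 : dist a' b' ^ 2 ≤ ((1 - η) * r₀) ^ 2 := by gcongr
        have h2 : (1 - 5 * η) ^ 2 + (1 - η) ^ 2 ≤ (√2 - η) ^ 2 := by nlinarith
        have h3 : ((1 - 5 * η) ^ 2 + (1 - η) ^ 2) * r₀ ^ 2 ≤ (√2 - η) ^ 2 * r₀ ^ 2 := by gcongr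
        nlinarith
      have hhm : MeasurableSet (Metric.closedBall a' ((1 - 5 * η) * r₀) ∩
          {z | 0 ≤ inner ℝ (z - a') (b' - a')}) :=
        measurableSet_closedBall.inter (isClosed_le continuous_const (by fun_prop)).measurableSet
      have hlow := le_law_of_le (f := f) hhm (l := ENNReal.ofReal l) fun z hz => by
        rw [← ENNReal.ofReal_coe_nnreal]
        refine ENNReal.ofReal_le_ofReal (hf z
          (Metric.closedBall_subset_closedBall' ?_ hz.1))
        rw [dist_comm] at ha'
        linarith
      have hvol := volume_half_ball_ge a' (b' - a') hR
      have hbern : 1 / 2 ≤ (1 - 5 * η) ^ d := by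
        have := one_add_mul_le_pow (a := -(5 * η)) (by linarith) d
        have e : (d : ℝ) * (5 * η) = 1 / 2 := by rw [hη]; field_simp; norm_num
        rw [← sub_eq_add_neg] at this
        linarith
      have hfin : ENNReal.ofReal (m / 4) ≤ law f (g a' b') := by
        refine le_trans ?_ (hlow.trans (measure_mono hhalf))
        refine le_trans ?_ (mul_le_mul_right hvol _)
        rw [← ENNReal.ofReal_mul hl.le]
        refine ENNReal.ofReal_le_ofReal ?_
        have : 1 / 2 * m ≤ (1 - 5 * η) ^ d * m := by gcongr
        rw [mul_pow]
        rw [hm] at this ⊢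
        linarith
      rw [← ofReal_measureReal] at hfin
      exact (ENNReal.ofReal_le_ofReal_iff measureReal_nonneg).1 hfin
    · have h1 : dist (x j) a' ≤ (1 - 5 * η) * r₀ := hj.1
      have h2 : dist (x j) b' ≤ (√2 - η) * r₀ := hj.2
      have h3 := dist_triangle (x j) a' a
      have h4 := dist_triangle b b' (x j)
      rw [dist_comm a' a] at h3
      rw [dist_comm b' (x j)] at h4
      have h5 := hgap j (by linarith)
      linarith
  · gcongr
    rw [le_div_iff₀ hmpos]
    have hpow : (η * r₀ / 2) ^ d = r₀ ^ d / (20 * d) ^ d := by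
      rw [← div_pow]; congr 1; rw [hη]; field_simp; norm_num
    rw [hpow] at hNcard
    have : (N.card : ℝ) * (l * (unitBallVolume d * (r₀ ^ d / (20 * d) ^ d))) =
        N.card * m / (20 * d) ^ d := by rw [hm]; field_simp
    rw [this, div_le_one (by positivity)] at hNcard
    exact hNcard

section Numerics

variable {n k : ℕ} {δ ε : ℝ}

lemma log_two_div_bounds (hδ0 : 0 < δ) (hδ1 : δ < 1) :
    0.69 ≤ Real.log (2 / δ) ∧ Real.exp (-(2 * Real.log (2 / δ))) ≤ δ / 4 := by
  have h2 : Real.log 2 ≤ Real.log (2 / δ) :=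
    Real.log_le_log two_pos (by rw [le_div_iff₀ hδ0]; linarith)
  refine ⟨by linarith [Real.log_two_gt_d9], ?_⟩
  calc Real.exp (-(2 * Real.log (2 / δ))) ≤ Real.exp (-Real.log (2 / δ) - Real.log 2) :=
        Real.exp_le_exp.2 (by linarith)
    _ = δ / 4 := by
      rw [Real.exp_sub, Real.exp_neg, Real.exp_log (by positivity), Real.exp_log two_pos]
      field_simp; norm_num

lemma natCast_mul_exp_le {Q ℓ L : ℝ} (hn : 0 < n) (hℓ : ℓ = Real.log n) (hQℓ : ℓ ≤ Q)
    (hQ : 0.69 ≤ Q) (hL : 0.69 ≤ L) {y : ℝ} (hy : 1000 * Q * L ^ 2 ≤ y) :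
    n * Real.exp (1 - y / 48) ≤ Real.exp (-(2 * L)) := by
  have hn' : (0 : ℝ) < n := by exact_mod_cast hn
  nth_rewrite 1 [← Real.exp_log hn']
  rw [← Real.exp_add, Real.exp_le_exp, ← hℓ]
  have h1 : 0.47 ≤ L ^ 2 := by nlinarith
  have h2 : 0.69 * L ≤ L ^ 2 := by nlinarith
  have h3 : 0.47 * Q ≤ Q * L ^ 2 := by nlinarith
  have h4 : 0.69 * L ^ 2 ≤ Q * L ^ 2 := by nlinarith
  linarith

/-- As `20 d ≤ n` and `m ≥ 1/n`, the net has at most `n^(d+1)` points; its square costs at most `4Q`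
in the exponent, against `125 Q L`. -/
lemma net_union_bound_le {Q ℓ L m : ℝ} (hd : 0 < d) (hn : 0 < n) (hℓ : ℓ = Real.log n)
    (hQ : Q = d * ℓ) (hQ0 : 0.69 ≤ Q) (hL : 0.69 ≤ L) (hdn : 20 * (d : ℝ) ≤ n)
    (hm : m = 1000 * Q * L / (2 * n)) :
    ((20 * (d : ℝ)) ^ d / m) ^ 2 * Real.exp (-(n * (m / 4))) ≤ Real.exp (-(2 * L)) := by
  have hn' : (0 : ℝ) < n := by exact_mod_cast hn
  have hd' : (1 : ℝ) ≤ d := by exact_mod_cast hd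
  have hℓ0 : 0 ≤ ℓ := by rw [hℓ]; exact Real.log_natCast_nonneg n
  have hQL : 0.47 ≤ Q * L := by nlinarith
  have hm1 : 1 / n ≤ m := by
    rw [hm, div_le_div_iff₀ hn' (by positivity)]
    nlinarith
  have hm0 : 0 < m := lt_of_lt_of_le (by positivity) hm1
  have hcard : (20 * (d : ℝ)) ^ d / m ≤ Real.exp ((d + 1) * ℓ) := by
    have e : Real.exp ((d + 1) * ℓ) = (n : ℝ) ^ d * n := by
      rw [add_mul, one_mul, Real.exp_add, Real.exp_nat_mul, hℓ, Real.exp_log hn']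
    rw [e, div_le_iff₀ hm0]
    calc (20 * (d : ℝ)) ^ d ≤ (n : ℝ) ^ d := by gcongr
      _ = (n : ℝ) ^ d * n * (1 / n) := by field_simp
      _ ≤ _ := by gcongr
  calc ((20 * (d : ℝ)) ^ d / m) ^ 2 * Real.exp (-(n * (m / 4)))
      ≤ Real.exp ((d + 1) * ℓ) ^ 2 * Real.exp (-(n * (m / 4))) := by gcongr
    _ = Real.exp (2 * ((d + 1) * ℓ) - n * (m / 4)) := by
      rw [← Real.exp_nat_mul, ← Real.exp_add]; push_cast; ring_nf
    _ ≤ _ := by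
      rw [Real.exp_le_exp]
      have h1 : n * (m / 4) = 125 * (Q * L) := by rw [hm]; field_simp; norm_num
      have h2 : (d + 1) * ℓ ≤ 2 * Q := by rw [hQ]; nlinarith
      have h3 : 0.69 * Q ≤ Q * L := by nlinarith
      have h4 : 0.69 * L ≤ Q * L := by nlinarith
      rw [h1]; linarith

end Numerics

end ClusterTree

/-! ### Typical samples and their consequences. -/

namespace ClusterTree

variable {d n k : ℕ} {δ ε : ℝ}

/-- The properties of the sample from which the structure of the graph is deduced: `r₀` is a lower
bound for the `k`-nearest-neighbour radii, and `l` is the least density level for which the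
connectedness of clusters is guaranteed. -/
structure TypicalSample (f : E d → ℝ≥0) (k : ℕ) (ε l r₀ : ℝ) (x : Fin n → E d) : Prop where
  density_ne_zero : ∀ i, f (x i) ≠ 0
  le_ncard : ∀ i, ∀ ρ : ℝ,
    ENNReal.ofReal (k / n * (1 + ε / 2)) ≤ law f (Metric.closedBall (x i) ρ) →
    k ≤ {j | x j ∈ Metric.closedBall (x i) ρ}.ncard
  ncard_lt : ∀ i, ∀ ρ : ℝ,
    law f (Metric.closedBall (x i) ρ) ≤ ENNReal.ofReal (k / n * (1 - ε / 2)) →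
    {j | x j ∈ Metric.closedBall (x i) ρ}.ncard < k
  exists_near : ∀ a b : E d, (∀ z ∈ Metric.closedBall a (2 * r₀), l ≤ f z) →
    dist b a ≤ (1 - 3 / (10 * d)) * r₀ →
    ∃ j, dist (x j) a < (1 - 3 / (10 * d)) * r₀ ∧ dist b (x j) ≤ √2 * r₀

lemma exists_typical_event {f : E d → ℝ≥0} {X : Set (E d)} (hf : IsDensityOn f X) (hd : 0 < d)
    (hk : 0 < k) (hδ0 : 0 < δ) (hδ1 : δ < 1) (hε0 : 0 < ε) (hε1 : ε < 1)
    (hkn : k * (1 + ε / 2) ≤ n)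
    (hC : 1000 * (d * Real.log n / ε ^ 2) * Real.log (2 / δ) ^ 2 ≤ k)
    {Λ r₀ : ℝ} (hΛ : 0 < Λ) (hr₀ : 0 < r₀) (hr : unitBallVolume d * r₀ ^ d = k / (2 * n * Λ)) :
    ∃ Ω : Set (Fin n → E d), MeasurableSet Ω ∧ ENNReal.ofReal (1 - δ) ≤ sampleLaw f n Ω ∧
      ∀ x ∈ Ω, TypicalSample f k ε
        (Λ * (1000 * d * Real.log n * Real.log (2 / δ)) / k) r₀ x := by
  have := hf.isProbabilityMeasure
  have : IsProbabilityMeasure (sampleLaw f n) := by unfold sampleLaw; infer_instance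
  have hk' : (1 : ℝ) ≤ k := by exact_mod_cast hk
  have hd' : (1 : ℝ) ≤ d := by exact_mod_cast hd
  have hn1 : (1 : ℝ) < n := by nlinarith
  have hn2 : 2 ≤ n := by exact_mod_cast hn1
  have hkn' : k ≤ n := by
    have : (k : ℝ) ≤ n := by nlinarith
    exact_mod_cast this
  obtain ⟨hL, hexp⟩ := log_two_div_bounds hδ0 hδ1
  set L := Real.log (2 / δ)
  set ℓ := Real.log n with hℓ
  have hℓ0 : 0.69 ≤ ℓ := by
    have : Real.log 2 ≤ ℓ := Real.log_le_log two_pos (by exact_mod_cast hn2)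
    linarith [Real.log_two_gt_d9]
  set Q : ℝ := d * ℓ with hQ
  have hℓQ : ℓ ≤ Q := by rw [hQ]; nlinarith
  have hdQ : 0.69 * d ≤ Q := by rw [hQ]; nlinarith
  have hy : 1000 * Q * L ^ 2 ≤ k * ε ^ 2 := by
    have e : 1000 * (Q / ε ^ 2) * L ^ 2 = 1000 * Q * L ^ 2 / ε ^ 2 := by ring
    rwa [e, div_le_iff₀ (by positivity)] at hC
  have hdn : 20 * (d : ℝ) ≤ n := by
    have h1 : (k : ℝ) * ε ^ 2 ≤ k := mul_le_of_le_one_right (by positivity) (by nlinarith)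
    have h2 : 0.47 ≤ L ^ 2 := by nlinarith
    have h3 : (0.69 * d) * 0.47 ≤ Q * L ^ 2 := by gcongr
    have h4 : (k : ℝ) ≤ n := by exact_mod_cast hkn'
    linarith
  set l : ℝ := Λ * (1000 * d * ℓ * L) / k with hl
  have hlpos : 0 < l := by positivity
  -- `Λ` cancels, so the failure probability does not depend on it.
  have hm : l * (unitBallVolume d * r₀ ^ d) = 1000 * Q * L / (2 * n) := by
    rw [hl, hr, hQ]; field_simp
  have hfew := measure_exists_ball_few_le f hd hk hε0 hε1 hkn
  have hmany := measure_exists_ball_many_le f hd hk hε0 hε1 hkn'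
  have hgap := measure_exists_gap_le f hd hlpos hr₀ n
  have hzero := measure_exists_density_eq_zero hf.measurable n
  set B₁ := {x : Fin n → E d | ∃ i, ∃ ρ : ℝ,
        ENNReal.ofReal (k / n * (1 + ε / 2)) ≤ law f (Metric.closedBall (x i) ρ) ∧
        {j | x j ∈ Metric.closedBall (x i) ρ}.ncard < k} with hB₁
  set B₂ := {x : Fin n → E d | ∃ i, ∃ ρ : ℝ,
        law f (Metric.closedBall (x i) ρ) ≤ ENNReal.ofReal (k / n * (1 - ε / 2)) ∧
        k ≤ {j | x j ∈ Metric.closedBall (x i) ρ}.ncard} with hB₂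
  set B₃ := {x : Fin n → E d | ∃ a b : E d, (∀ z ∈ Metric.closedBall a (2 * r₀), l ≤ f z) ∧
        dist b a ≤ (1 - 3 / (10 * d)) * r₀ ∧
        ∀ j, dist (x j) a < (1 - 3 / (10 * d)) * r₀ → √2 * r₀ < dist b (x j)} with hB₃
  set B₀ := {x : Fin n → E d | ∃ i, f (x i) = 0} with hB₀
  have hnum := natCast_mul_exp_le (n := n) (by omega) hℓ hℓQ (hℓ0.trans hℓQ) hL hy
  have h1 : sampleLaw f n B₁ ≤ ENNReal.ofReal (δ / 4) := by
    refine hfew.trans (ENNReal.ofReal_le_ofReal (le_trans ?_ (hnum.trans hexp)))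
    gcongr
    linarith
  have h2 : sampleLaw f n B₂ ≤ ENNReal.ofReal (δ / 4) :=
    hmany.trans (ENNReal.ofReal_le_ofReal (hnum.trans hexp))
  have h3 : sampleLaw f n B₃ ≤ ENNReal.ofReal (δ / 4) :=
    hgap.trans (ENNReal.ofReal_le_ofReal ((net_union_bound_le hd (by omega) hℓ hQ
      (hℓ0.trans hℓQ) hL hdn hm).trans hexp))
  have hbad : sampleLaw f n (B₀ ∪ B₁ ∪ B₂ ∪ B₃) ≤ ENNReal.ofReal δ := by
    calc sampleLaw f n (B₀ ∪ B₁ ∪ B₂ ∪ B₃)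
        ≤ 0 + ENNReal.ofReal (δ / 4) + ENNReal.ofReal (δ / 4) + ENNReal.ofReal (δ / 4) := by
          refine (measure_union_le _ _).trans (add_le_add ?_ h3)
          refine (measure_union_le _ _).trans (add_le_add ?_ h2)
          exact (measure_union_le _ _).trans (add_le_add hzero.le h1)
      _ ≤ ENNReal.ofReal δ := by
          rw [zero_add, ← ENNReal.ofReal_add (by positivity) (by positivity),
            ← ENNReal.ofReal_add (by positivity) (by positivity)]
          exact ENNReal.ofReal_le_ofReal (by linarith)
  -- Passing to a measurable hull avoids proving the bad events measurable.
  refine ⟨(toMeasurable (sampleLaw f n) (B₀ ∪ B₁ ∪ B₂ ∪ B₃))ᶜ,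
    (measurableSet_toMeasurable _ _).compl, ?_, fun x hx => ?_⟩
  · rw [prob_compl_eq_one_sub (measurableSet_toMeasurable _ _), measure_toMeasurable,
      ENNReal.ofReal_sub _ hδ0.le, ENNReal.ofReal_one]
    exact tsub_le_tsub_left hbad 1
  · have hx' : x ∉ B₀ ∪ B₁ ∪ B₂ ∪ B₃ := fun h => hx (subset_toMeasurable _ _ h)
    simp only [Set.mem_union, not_or] at hx'
    obtain ⟨⟨⟨hx0, hx1⟩, hx2⟩, hx3⟩ := hx'
    refine ⟨fun i hi => hx0 ⟨i, hi⟩, fun i ρ h => ?_, fun i ρ h => ?_, fun a b h h' => ?_⟩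
    · by_contra hcon; exact hx1 ⟨i, ρ, h, not_le.1 hcon⟩
    · by_contra hcon; exact hx2 ⟨i, ρ, h, not_lt.1 hcon⟩
    · by_contra! hcon; exact hx3 ⟨a, b, h, h', hcon⟩

variable {f : E d → ℝ≥0} {x : Fin n → E d} {l r₀ Λ σ α : ℝ} {v : Variant} {r lev : ℝ≥0}

lemma TypicalSample.connectedIn (hx : TypicalSample f k ε l r₀ x) (hd : 0 < d)
    (hε1 : ε < 1) (hα : √2 ≤ α) (hΛ : 0 < Λ) (hfΛ : ∀ y, f y ≤ Λ) (hr₀ : 0 < r₀)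
    (hr₀Λ : unitBallVolume d * r₀ ^ d = k / (2 * n * Λ)) (hr₀r : r₀ ≤ r)
    (hr : unitBallVolume d * (r : ℝ) ^ d * lev = k / n * (1 + ε / 2)) (hrσ : 2 * (r : ℝ) ≤ σ)
    (hl : l ≤ lev) {A : Set (E d)} (hA : IsPreconnected A)
    (hlev : ∀ z ∈ Metric.cthickening σ A, lev ≤ f z) :
    ConnectedIn x (nnGraph v α k x r) A := by
  have hd' : (1 : ℝ) ≤ d := by exact_mod_cast hd
  have hfrac0 : (0 : ℝ) < 3 / (10 * d) := by positivity
  have hfrac1 : (3 : ℝ) / (10 * d) ≤ 1 := by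
    rw [div_le_one (by positivity)]; linarith
  have hs1 : 1 ≤ √2 := Real.one_le_sqrt.2 (by norm_num)
  have hsr : (1 - 3 / (10 * d)) * r₀ ≤ r₀ := by nlinarith
  refine connectedIn_nnGraph (s := (1 - 3 / (10 * d)) * r₀) (r₀ := r₀) hα
    (mul_nonneg (by linarith) hr₀.le) (hsr.trans (by nlinarith)) hA ?_ ?_ ?_
  · intro a ha i hi
    refine knnRadius_le (hx.le_ncard i r ?_)
    have := le_law_of_le (f := f) (g := Metric.closedBall (x i) r) measurableSet_closedBall
      (l := lev) fun z hz => by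
        refine ENNReal.coe_le_coe.2 (hlev z (Metric.closedBall_subset_cthickening ha σ
          (Metric.closedBall_subset_closedBall' ?_ hz)))
        linarith
    rwa [volume_closedBall_eq _ r.coe_nonneg, ← ENNReal.ofReal_coe_nnreal,
      ← ENNReal.ofReal_mul lev.coe_nonneg, mul_comm, hr] at this
  · intro i
    refine le_knnRadius (r := NNReal.mk r₀ hr₀.le) (hx.ncard_lt i r₀ ?_) |>.trans' (le_of_eq ?_)
    · have := law_le_of_le (f := f) (g := Metric.closedBall (x i) r₀) measurableSet_closedBall
        (l := ENNReal.ofReal Λ) fun z _ => by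
          rw [← ENNReal.ofReal_coe_nnreal]
          exact ENNReal.ofReal_le_ofReal (hfΛ z)
      refine this.trans ?_
      rw [volume_closedBall_eq _ hr₀.le, ← ENNReal.ofReal_mul hΛ.le, hr₀Λ]
      refine ENNReal.ofReal_le_ofReal ?_
      -- The `2` in the choice of `r₀` is used here: `1/2 ≤ 1 - ε/2`.
      have e : Λ * (k / (2 * n * Λ)) = k / n * (1 / 2) := by field_simp
      rw [e]
      gcongr
      linarith
    · exact ENNReal.ofReal_eq_coe_nnreal hr₀.le
  · intro a ha i hi
    refine hx.exists_near a (x i) (fun z hz => hl.trans ?_) hi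
    exact_mod_cast hlev z (Metric.closedBall_subset_cthickening ha σ
      (Metric.closedBall_subset_closedBall (by linarith) hz))

lemma TypicalSample.disconnectedIn (hx : TypicalSample f k ε l r₀ x) {X : Set (E d)}
    (hf : IsDensityOn f X) (hε0 : 0 < ε) (hε1 : ε < 1) (hα : α ≤ 2)
    (hconv : ConvexAtScale X σ) {A A' : Set (E d)} (hsep : Separated X f σ ε A A')
    (hr : unitBallVolume d * (r : ℝ) ^ d * level f σ A A' = k / n * (1 + ε / 2))
    (hrσ : 2 * (r : ℝ) ≤ σ) :
    DisconnectedIn x (nnGraph v α k x r) A A' := by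
  obtain ⟨S, -, hS, hlow⟩ := hsep
  refine disconnectedIn_nnGraph hα (fun i => ?_) hconv hrσ hS fun i s hs his => ?_
  · by_contra hi
    exact hx.density_ne_zero i (hf.eq_zero_of_notMem _ hi)
  refine lt_knnRadius (hx.ncard_lt i r ?_)
  have := law_le_of_le (f := f) (g := Metric.closedBall (x i) r) measurableSet_closedBall
    (l := ENNReal.ofReal (1 - ε) * level f σ A A') fun z hz =>
      (le_iSup₂ (f := fun y (_ : y ∈ Metric.cthickening σ S) => (f y : ℝ≥0∞)) z
        (Metric.closedBall_subset_cthickening hs σ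
          (Metric.closedBall_subset_closedBall' (by linarith) hz))).trans hlow.le
  refine this.trans ?_
  have hε : 0 ≤ 1 - ε := by linarith
  rw [volume_closedBall_eq _ r.coe_nonneg, ← ENNReal.ofReal_coe_nnreal, ← ENNReal.ofReal_mul hε,
    ← ENNReal.ofReal_mul (mul_nonneg hε (level f σ A A').coe_nonneg)]
  refine ENNReal.ofReal_le_ofReal ?_
  have e : (1 - ε) * (level f σ A A' : ℝ) * (unitBallVolume d * (r : ℝ) ^ d) =
      k / n * ((1 - ε) * (1 + ε / 2)) := by
    linear_combination (1 - ε) * hr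
  refine e.le.trans ?_
  gcongr
  nlinarith

lemma level_le {A A' : Set (E d)} {z : E d}
    (hz : z ∈ Metric.cthickening σ A ∪ Metric.cthickening σ A') : level f σ A A' ≤ f z :=
  csInf_le' ⟨z, hz, rfl⟩

/-- The strict inequality in the separation fails at level zero. -/
lemma Separated.level_pos {X A A' : Set (E d)} (h : Separated X f σ ε A A') :
    0 < level f σ A A' := by
  obtain ⟨S, -, -, hlow⟩ := h
  refine pos_iff_ne_zero.2 fun h0 => ?_
  simp [h0] at hlow

lemma exists_radius (hd : 0 < d) (a : ℝ) (ha : 0 ≤ a) :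
    ∃ r : ℝ≥0, unitBallVolume d * (r : ℝ) ^ d = a := by
  have hV := unitBallVolume_pos (d := d)
  refine ⟨NNReal.mk ((a / unitBallVolume d) ^ (1 / d : ℝ)) (by positivity), ?_⟩
  rw [NNReal.coe_mk, one_div, Real.rpow_inv_natCast_pow (by positivity) hd.ne']
  field_simp

end ClusterTree

/-! ### Degenerate cases and the theorem. -/

namespace ClusterTree

variable {d n k : ℕ} {f : E d → ℝ≥0}

lemma IsDensityOn.exists_bound {X : Set (E d)} (hf : IsDensityOn f X)
    (htop : (⨆ y ∈ X, (f y : ℝ≥0∞)) ≠ ⊤) :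
    ∃ Λ : ℝ, 0 < Λ ∧ (∀ y, f y ≤ Λ) ∧ (⨆ y ∈ X, (f y : ℝ≥0∞)) = ENNReal.ofReal Λ := by
  have hle : ∀ y, (f y : ℝ≥0∞) ≤ ⨆ y ∈ X, (f y : ℝ≥0∞) := fun y => by
    by_cases hy : y ∈ X
    · exact le_iSup₂ (f := fun y (_ : y ∈ X) => (f y : ℝ≥0∞)) y hy
    · simp [hf.eq_zero_of_notMem y hy]
  refine ⟨(⨆ y ∈ X, (f y : ℝ≥0∞)).toReal, ENNReal.toReal_pos (fun h0 => ?_) htop, fun y => ?_,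
    (ENNReal.ofReal_toReal htop).symm⟩
  · have h1 := hf.lintegral_eq_one
    rw [lintegral_congr (g := fun _ => 0) fun y => le_antisymm ((hle y).trans h0.le) zero_le] at h1
    simp at h1
  · exact ENNReal.toReal_mono htop (hle y)

lemma ball_mass_le_one [IsProbabilityMeasure (law f)] {σ : ℝ} (hσ : 0 < σ) {A A' : Set (E d)}
    (hA : A.Nonempty) : unitBallVolume d * (σ / 2) ^ d * level f σ A A' ≤ 1 := by
  obtain ⟨a, ha⟩ := hA
  have h1 := le_law_of_le (f := f) (g := Metric.closedBall a (σ / 2)) measurableSet_closedBall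
    (l := level f σ A A') fun z hz => ENNReal.coe_le_coe.2 (level_le (Or.inl
      (Metric.closedBall_subset_cthickening ha σ
        (Metric.closedBall_subset_closedBall (by linarith) hz))))
  have h2 := h1.trans prob_le_one
  rw [volume_closedBall_eq _ (by positivity), ← ENNReal.ofReal_coe_nnreal,
    ← ENNReal.ofReal_mul (level f σ A A').coe_nonneg, ENNReal.ofReal_le_one] at h2
  rwa [mul_comm]

end ClusterTree

open ClusterTree in
theorem theorem2 :
    ∃ C : ℝ, 0 < C ∧
      ∀ (d n k : ℕ) (δ ε α : ℝ) (v : ClusterTree.Variant)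
        (X : Set (ClusterTree.E d)) (f : ClusterTree.E d → ℝ≥0),
        0 < d → 0 < n → 0 < k → 0 < δ → δ < 1 → 0 < ε → ε < 1 → √2 ≤ α → α ≤ 2 →
        ClusterTree.IsDensityOn f X →
        C * (d * Real.log n / ε ^ 2) * Real.log (2 / δ) ^ 2 ≤ k →
        ∃ r : ℝ≥0 → ℝ≥0,
          (∀ l : ℝ≥0, 0 < l →
            (k / n : ℝ) ≤ ClusterTree.unitBallVolume d * (r l : ℝ) ^ d * l ∧
            ClusterTree.unitBallVolume d * (r l : ℝ) ^ d * l ≤ (k / n : ℝ) * (1 + ε / 2)) ∧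
          ∃ Ω : Set (Fin n → ClusterTree.E d),
            MeasurableSet Ω ∧
            ENNReal.ofReal (1 - δ) ≤ ClusterTree.sampleLaw f n Ω ∧
            ∀ x ∈ Ω, ∀ (σ : ℝ) (A A' : Set (ClusterTree.E d)),
              0 < σ → ClusterTree.ConvexAtScale X σ →
              A ⊆ X → A' ⊆ X → IsPathConnected A → IsPathConnected A' →
              ClusterTree.Separated X f σ ε A A' →
              (k : ℝ) / (ClusterTree.unitBallVolume d * (σ / 2) ^ d *
                  (ClusterTree.level f σ A A' : ℝ)) * (1 + ε / 2) ≤ n →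
              (⨆ y ∈ X, (f y : ℝ≥0∞)) / (ClusterTree.level f σ A A' : ℝ≥0∞) *
                  ENNReal.ofReal (C * d * Real.log n * Real.log (2 / δ)) ≤ (k : ℝ≥0∞) →
              ClusterTree.DisconnectedIn x
                (ClusterTree.nnGraph v α k x (r (ClusterTree.level f σ A A'))) A A' ∧
              ClusterTree.ConnectedIn x
                (ClusterTree.nnGraph v α k x (r (ClusterTree.level f σ A A'))) A ∧
              ClusterTree.ConnectedIn x
                (ClusterTree.nnGraph v α k x (r (ClusterTree.level f σ A A'))) A' := by
  refine ⟨1000, by norm_num, ?_⟩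
  intro d n k δ ε α v X f hd hn hk hδ0 hδ1 hε0 hε1 hα hα2 hf hC
  have hprob := hf.isProbabilityMeasure
  have hsprob : IsProbabilityMeasure (sampleLaw f n) := by unfold sampleLaw; infer_instance
  have hn' : (0 : ℝ) < n := by exact_mod_cast hn
  have hk' : (1 : ℝ) ≤ k := by exact_mod_cast hk
  have hV := unitBallVolume_pos (d := d)
  choose r hr using fun l : ℝ≥0 =>
    exists_radius hd (k / n * (1 + ε / 2) / (l : ℝ)) (by positivity)
  have hrl : ∀ l : ℝ≥0, 0 < l →
      unitBallVolume d * (r l : ℝ) ^ d * l = k / n * (1 + ε / 2) := fun l hl => by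
    rw [hr, div_mul_cancel₀]; exact_mod_cast hl.ne'
  refine ⟨r, fun l hl => ⟨?_, (hrl l hl).le⟩, ?_⟩
  · rw [hrl l hl]
    exact le_mul_of_one_le_right (by positivity) (by linarith)
  have hlarge : ∀ (σ : ℝ) (A A' : Set (E d)), 0 < σ → A.Nonempty → Separated X f σ ε A A' →
      (k : ℝ) / (unitBallVolume d * (σ / 2) ^ d * (level f σ A A' : ℝ)) * (1 + ε / 2) ≤ n →
      k * (1 + ε / 2) ≤ n := by
    intro σ A A' hσ hA hsep hnσ
    have hlev : (0 : ℝ) < level f σ A A' := hsep.level_pos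
    refine le_trans ?_ hnσ
    gcongr
    exact le_div_self (by positivity) (by positivity) (ball_mass_le_one hσ hA)
  -- Otherwise no `σ, A, A'` satisfy the hypotheses, by `hlarge`, and the whole sample space serves
  -- as `Ω`; likewise below if `f` is unbounded.
  by_cases hkn : k * (1 + ε / 2) ≤ n
  swap
  · refine ⟨Set.univ, MeasurableSet.univ, ?_, ?_⟩
    · rw [measure_univ, ENNReal.ofReal_le_one]; linarith
    · intro x _ σ A A' hσ _ _ _ hA _ hsep hnσ
      exact absurd (hlarge σ A A' hσ hA.nonempty hsep hnσ) hkn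
  have hlogn : 0 < Real.log n := Real.log_pos (by nlinarith)
  have hL : 0 < Real.log (2 / δ) := Real.log_pos (by rw [lt_div_iff₀ hδ0]; linarith)
  by_cases htop : (⨆ y ∈ X, (f y : ℝ≥0∞)) = ⊤
  · refine ⟨Set.univ, MeasurableSet.univ, ?_, ?_⟩
    · rw [measure_univ, ENNReal.ofReal_le_one]; linarith
    · intro x _ σ A A' _ _ _ _ _ _ _ _ hkΛ
      rw [htop, ENNReal.top_div_coe, ENNReal.top_mul] at hkΛ
      · exact absurd hkΛ (by simp)
      · have : 0 < 1000 * d * Real.log n * Real.log (2 / δ) := by positivity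
        simpa using this
  obtain ⟨Λ, hΛ, hfΛ, hsup⟩ := hf.exists_bound htop
  obtain ⟨r₀, hr₀Λ⟩ := exists_radius hd (k / (2 * n * Λ)) (by positivity)
  have hr₀ : 0 < (r₀ : ℝ) := by
    refine r₀.coe_nonneg.lt_of_ne fun h0 => ?_
    rw [← h0, zero_pow hd.ne', mul_zero] at hr₀Λ
    have : 0 < k / (2 * n * Λ) := by positivity
    linarith
  obtain ⟨Ω, hΩm, hΩ, htyp⟩ := exists_typical_event hf hd hk hδ0 hδ1 hε0 hε1 hkn hC hΛ hr₀ hr₀Λ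
  refine ⟨Ω, hΩm, hΩ, ?_⟩
  intro x hx σ A A' hσ hconv _ _ hA hA' hsep hnσ hkΛ
  have hpos := hsep.level_pos
  set lev := level f σ A A' with hlev
  have hpos' : (0 : ℝ) < lev := hpos
  have hlevΛ : (lev : ℝ) ≤ Λ := by
    obtain ⟨a, ha⟩ := hA.nonempty
    refine le_trans ?_ (hfΛ a)
    exact_mod_cast level_le (Or.inl (Metric.self_subset_cthickening A ha))
  have hrσ : 2 * (r lev : ℝ) ≤ σ := by
    have h1 : unitBallVolume d * lev * (r lev : ℝ) ^ d ≤
        unitBallVolume d * lev * (σ / 2) ^ d := by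
      rw [mul_right_comm, hrl lev hpos, div_mul_eq_mul_div, div_le_iff₀ hn']
      rw [div_mul_eq_mul_div, div_le_iff₀ (by positivity)] at hnσ
      linarith
    have h2 := (pow_le_pow_iff_left₀ (r lev).coe_nonneg (by positivity) hd.ne').1
      (le_of_mul_le_mul_left h1 (by positivity))
    linarith
  have hr₀r : (r₀ : ℝ) ≤ r lev := by
    refine (pow_le_pow_iff_left₀ r₀.coe_nonneg (r lev).coe_nonneg hd.ne').1
      (le_of_mul_le_mul_left ?_ hV)
    rw [hr₀Λ, hr, div_mul_eq_mul_div, div_div]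
    gcongr
    · nlinarith
    · nlinarith
  -- The second lower bound on `k`, solved for the level.
  have hl : Λ * (1000 * d * Real.log n * Real.log (2 / δ)) / k ≤ lev := by
    rw [hsup, ← ENNReal.ofReal_coe_nnreal, ← ENNReal.ofReal_div_of_pos hpos',
      ← ENNReal.ofReal_mul (by positivity), ← ENNReal.ofReal_natCast,
      ENNReal.ofReal_le_ofReal_iff (by positivity), div_mul_eq_mul_div,
      div_le_iff₀ hpos'] at hkΛ
    rw [div_le_iff₀ (by positivity)]
    linarith
  have htx := htyp x hx
  exact ⟨htx.disconnectedIn hf hε0 hε1 hα2 hconv hsep (hrl lev hpos) hrσ,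
    htx.connectedIn hd hε1 hα hΛ hfΛ hr₀ hr₀Λ hr₀r (hrl lev hpos) hrσ hl
      hA.isConnected.isPreconnected fun z hz => level_le (Or.inl hz),
    htx.connectedIn hd hε1 hα hΛ hfΛ hr₀ hr₀Λ hr₀r (hrl lev hpos) hrσ hl
      hA'.isConnected.isPreconnected fun z hz => level_le (Or.inr hz)⟩
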